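/- Let $\mathbf N(\cdot;\theta):\mathbb R^\ell\to\mathbb R^d$ be a family of neural network maps of a fixed architecture, indexed by the parameter $\theta$. For a given training data set $D$ and a chosen stochastic optimization algorithm with settings $\mathcal S$, let $\mathcal D_\Theta$ be the probability distribution of the parameter $\Theta$ produced by one training. For each $K\ge 1$ let $\Theta^{(1)},\dots,\Theta^{(K)}$ be the parameters obtained from $K$ independent trainings, so that they are i.i.d. with law $\mathcal D_\Theta$. Put $\mathbf N^{(i)}=\mathbf N(\cdot;\Theta^{(i)})$ and let $$\mathbf N^{(A)}(\cdot)=\frac1K\sum_{i=1}^K\mathbf N^{(i)}(\cdot)$$ be the ensemble-averaged network. Fix an input $\mathbf x\in\mathbb R^\ell$, assume that $\mathbf N(\mathbf x;\Theta)$ with $\Theta\sim\mathcal D_\Theta$ has a finite second moment, $\mathbb E\|\mathbf N(\mathbf x;\Theta)\|^2<\infty$, and let $$\boldsymbol\nu(\mathbf x)=\mathbb E[\mathbf N(\mathbf x;\Theta)],\qquad \boldsymbol\Sigma(\mathbf x)=\operatorname{Cov}(\mathbf N(\mathbf x;\Theta)).$$ Then $$\sqrt K\,\bigl(\mathbf N^{(A)}(\mathbf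 x)-\boldsymbol\nu(\mathbf x)\bigr)\;\longrightarrow\;\mathcal N_d\bigl(\mathbf 0,\boldsymbol\Sigma(\mathbf x)\bigr)\qquad (K\to\infty)$$ in distribution, where $\mathcal N_d(\mathbf 0,\boldsymbol\Sigma(\mathbf x))$ is the (possibly degenerate) $d$-variate normal distribution with mean zero and covariance matrix $\boldsymbol\Sigma(\mathbf x)$. -/

import Mathlib

open MeasureTheory ProbabilityTheory Filter

noncomputable section

namespace EnsembleAveraging

variable {X Par : Type*} {d : ℕ}

/-- Mean `ν(x) = E[N(x; Θ)]` of the network output at the input `x`, where the parameters `Θ` are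
distributed according to `DΘ`. -/
def outputMean [MeasurableSpace Par] (N : X → Par → EuclideanSpace ℝ (Fin d)) (DΘ : Measure Par)
    (x : X) : EuclideanSpace ℝ (Fin d) :=
  ∫ θ, N x θ ∂DΘ

/-- Covariance matrix `Σ(x) = Cov(N(x; Θ))` of the network output at the input `x`, where the
parameters `Θ` are distributed according to `DΘ`. -/
def outputCov [MeasurableSpace Par] (N : X → Par → EuclideanSpace ℝ (Fin d)) (DΘ : Measure Par)
    (x : X) : Matrix (Fin d) (Fin d) ℝ :=
  Matrix.of fun i j => cov[fun θ => N x θ i, fun θ => N x θ j; DΘ]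

/-- The ensemble-averaged network `N^{(A)} = (1/K) ∑ᵢ N(·; θᵢ)` with parameters `θ₁, …, θ_K`. -/
def ensembleAverage (N : X → Par → EuclideanSpace ℝ (Fin d)) {K : ℕ} (θ : Fin K → Par) (x : X) :
    EuclideanSpace ℝ (Fin d) :=
  (1 / (K : ℝ)) • ∑ i, N x (θ i)

end EnsembleAveraging

end

/-! By Lévy's continuity theorem it suffices to prove pointwise convergence of characteristic
functions. At `t`, independence turns that of the rescaled average into the `K`-th power of the
characteristic function of the centered scalar `⟨t, N x θ - ν⟩` at `1/√K`. Its second-order Taylor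
expansion gives the limit `exp(-Var/2)`, and this variance is the quadratic form of `Σ(x)` at `t`.
Each `K` may use its own probability space, since only laws enter. -/

open Complex in
/-- If `Y` is centered and square integrable, the characteristic functions of the normalized sums
of independent copies of `Y` converge, at the point `1`, to that of a Gaussian variable. -/
lemma tendsto_charFun_inv_sqrt_pow {Ω : Type*} [MeasurableSpace Ω] {P : Measure Ω}
    [IsProbabilityMeasure P] {Y : Ω → ℝ} (hY : MemLp Y 2 P) (h0 : P[Y] = 0) :
    Tendsto (fun n : ℕ => charFun (P.map Y) (√(n : ℝ))⁻¹ ^ n) atTop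
      (nhds (exp (-(Var[Y; P] : ℂ) / 2))) := by
  have hYm : AEMeasurable Y P := hY.aemeasurable
  have : IsProbabilityMeasure (P.map Y) := Measure.isProbabilityMeasure_map hYm
  have hid : MemLp id 2 (P.map Y) := (memLp_map_measure_iff (by fun_prop) hYm).2 hY
  have htaylor : (fun t : ℝ => charFun (P.map Y) t - (1 - (Var[Y; P] : ℂ) * t ^ 2 / 2))
      =o[nhds 0] fun t : ℝ => t ^ 2 := by
    have h := taylor_isLittleO_univ (x₀ := 0) (contDiff_charFun (n := 2) (by simpa using hid))
    simp only [taylorWithinEval_charFun_two_zero hYm hid, h0, sub_zero] at h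
    simpa [variance_of_integral_eq_zero hYm h0] using h
  have hlim : Tendsto (fun n : ℕ => (√(n : ℝ))⁻¹) atTop (nhds 0) :=
    tendsto_inv_atTop_zero.comp (Real.tendsto_sqrt_atTop.comp tendsto_natCast_atTop_atTop)
  -- `(1 + z/n + o(1/n))^n → exp z` with `z = -Var/2`; the remainder is the Taylor error at `1/√n`.
  apply tendsto_pow_exp_of_isLittleO_sub_add_div
  have h := htaylor.comp_tendsto hlim
  rw [← Asymptotics.isLittleO_norm_right] at h ⊢
  refine h.congr (fun n => ?_) (fun n => ?_)
  · have : ((√(n : ℝ) : ℝ) : ℂ) ^ 2 = n := by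
      rw [← ofReal_pow, Real.sq_sqrt n.cast_nonneg, ofReal_natCast]
    simp only [Function.comp_apply, ofReal_inv, inv_pow, this]
    ring
  · simp [Real.sq_sqrt n.cast_nonneg]

/-- The characteristic function of the normalized sum of i.i.d. random vectors. -/
lemma charFun_map_inv_sqrt_smul_sum {Ω ι E : Type*} [MeasurableSpace Ω] {P : Measure Ω}
    [Fintype ι] [NormedAddCommGroup E] [InnerProductSpace ℝ E] [MeasurableSpace E] [BorelSpace E]
    [SecondCountableTopology E] [CompleteSpace E] {Y : ι → Ω → E} {μ : Measure E}
    (hlaw : ∀ i, HasLaw (Y i) μ P) (hindep : iIndepFun Y P) (r : ℝ) (t : E) :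
    charFun (P.map fun ω => r • ∑ i, Y i ω) t = charFun μ (r • t) ^ Fintype.card ι := by
  have hm i : AEMeasurable (Y i) P := (hlaw i).aemeasurable
  rw [charFun_map_smul_comp (by fun_prop), hindep.charFun_map_fun_sum_eq_prod hm]
  simp [(hlaw _).map_eq]

/-- The characteristic function of a random vector along a line, in terms of its projection. -/
lemma charFun_map_smul_eq_charFun_map_inner {Ω E : Type*} [MeasurableSpace Ω] {P : Measure Ω}
    [NormedAddCommGroup E] [InnerProductSpace ℝ E] [MeasurableSpace E] [BorelSpace E]
    [SecondCountableTopology E] {Y : Ω → E} (hY : AEMeasurable Y P) (r : ℝ) (t : E) :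
    charFun (P.map Y) (r • t) = charFun (P.map fun ω => inner ℝ t (Y ω)) r := by
  rw [charFun_apply, charFun_apply_real, integral_map hY (by fun_prop),
    integral_map (by fun_prop) (by fun_prop)]
  simp [inner_smul_right, real_inner_comm]

namespace EnsembleAveraging

variable {X Par : Type*} {d : ℕ} {N : X → Par → EuclideanSpace ℝ (Fin d)} {x : X}

lemma sqrt_smul_ensembleAverage_sub {K : ℕ} (hK : K ≠ 0) (θ : Fin K → Par)
    (ν : EuclideanSpace ℝ (Fin d)) :
    √(K : ℝ) • (ensembleAverage N θ x - ν) = (√(K : ℝ))⁻¹ • ∑ i, (N x (θ i) - ν) := by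
  have hK' : (K : ℝ) ≠ 0 := by exact_mod_cast hK
  have hsum : ∑ i, (N x (θ i) - ν) = (K : ℝ) • (ensembleAverage N θ x - ν) := by
    simp [ensembleAverage, smul_sub, smul_smul, hK', Nat.cast_smul_eq_nsmul]
  rw [hsum, smul_smul, inv_mul_eq_div, Real.div_sqrt]

variable [MeasurableSpace Par] {DΘ : Measure Par}

/-- Bilinearity of covariance. This links the scalar limits to the Gaussian and makes `Σ(x)`
positive semidefinite. -/
lemma dotProduct_outputCov_mulVec [IsFiniteMeasure DΘ] (hN : MemLp (N x) 2 DΘ)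
    (t : EuclideanSpace ℝ (Fin d)) :
    t.ofLp ⬝ᵥ (outputCov N DΘ x).mulVec t.ofLp = Var[fun θ => inner ℝ t (N x θ); DΘ] := by
  have hcoord i : MemLp (fun θ => t i * N x θ i) 2 DΘ :=
    MemLp.const_mul (hN.continuousLinearMap_comp (EuclideanSpace.proj (𝕜 := ℝ) i)) (t i)
  have hinner : (fun θ => inner ℝ t (N x θ)) = fun θ => ∑ i, t i * N x θ i := by
    ext θ
    simp [PiLp.inner_apply, mul_comm]
  rw [hinner, variance_fun_sum hcoord]
  simp only [dotProduct, Matrix.mulVec, outputCov, Matrix.of_apply, Finset.mul_sum,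
    covariance_const_mul_left, covariance_const_mul_right]
  refine Finset.sum_congr rfl fun i _ => Finset.sum_congr rfl fun j _ => ?_
  ring

lemma posSemidef_outputCov [IsFiniteMeasure DΘ] (hN : MemLp (N x) 2 DΘ) :
    (outputCov N DΘ x).PosSemidef := by
  refine .of_dotProduct_mulVec_nonneg ?_ fun v => ?_
  · ext i j
    simp [outputCov, covariance_comm]
  · simpa [← dotProduct_outputCov_mulVec hN (WithLp.toLp 2 v)] using
      variance_nonneg (fun θ => inner ℝ (WithLp.toLp 2 v) (N x θ)) DΘ

end EnsembleAveraging

/-- For every `K`, the parameters `Θ K 0, …, Θ K (K - 1)` of `K` independently trained networks are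
i.i.d. with law `DΘ` on some probability space `(Ω K, P K)`, which may depend on `K`. -/
theorem mainTheorem1 {X Par : Type*} [MeasurableSpace Par] {d : ℕ}
    (N : X → Par → EuclideanSpace ℝ (Fin d))
    (DΘ : Measure Par) [IsProbabilityMeasure DΘ]
    {Ω : ℕ → Type*} [∀ K, MeasurableSpace (Ω K)]
    (P : (K : ℕ) → Measure (Ω K)) [∀ K, IsProbabilityMeasure (P K)]
    (Θ : (K : ℕ) → Fin K → Ω K → Par)
    (hlaw : ∀ K i, HasLaw (Θ K i) DΘ (P K))
    (hindep : ∀ K, iIndepFun (Θ K) (P K))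
    (x : X) (hN : MemLp (N x) 2 DΘ) :
    TendstoInDistribution
      (fun (K : ℕ) (ω : Ω K) =>
        √(K : ℝ) • (EnsembleAveraging.ensembleAverage N (fun i => Θ K i ω) x
          - EnsembleAveraging.outputMean N DΘ x))
      atTop
      (id : EuclideanSpace ℝ (Fin d) → EuclideanSpace ℝ (Fin d))
      P
      (multivariateGaussian 0 (EnsembleAveraging.outputCov N DΘ x)) := by
  have hNm : AEMeasurable (N x) DΘ := hN.aemeasurable
  set ν := EnsembleAveraging.outputMean N DΘ x with hν
  have hcm : AEMeasurable (fun θ => N x θ - ν) DΘ := hNm.sub_const ν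
  have hclaw K i : HasLaw (fun ω => N x (Θ K i ω) - ν) (DΘ.map fun θ => N x θ - ν) (P K) :=
    HasLaw.fun_comp (Y := fun θ => N x θ - ν) ⟨hcm, rfl⟩ (hlaw K i)
  -- `N x` is only a.e. measurable for `DΘ`; this suffices because every `Θ K i` has law `DΘ`.
  have hcindep K : iIndepFun (fun i ω => N x (Θ K i ω) - ν) (P K) :=
    (hindep K).comp₀ (fun _ θ => N x θ - ν) (fun i => (hlaw K i).aemeasurable)
      fun i => by rwa [(hlaw K i).map_eq]
  have hm K i : AEMeasurable (fun ω => N x (Θ K i ω)) (P K) := by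
    simpa using (hclaw K i).aemeasurable.add_const ν
  refine ⟨fun K => ?_, by fun_prop, ProbabilityMeasure.tendsto_iff_tendsto_charFun.2 fun t => ?_⟩
  · unfold EnsembleAveraging.ensembleAverage
    have hsum := Finset.aemeasurable_fun_sum Finset.univ fun i _ => hm K i
    exact ((hsum.const_smul (1 / (K : ℝ))).sub_const ν).const_smul √(K : ℝ)
  have hint : Integrable (N x) DΘ := hN.integrable one_le_two
  have hL : MemLp (fun θ => inner ℝ t (N x θ)) 2 DΘ := hN.const_inner t
  have hsub : (fun θ => inner ℝ t (N x θ - ν)) =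
      fun θ => inner ℝ t (N x θ) - inner ℝ t ν := by
    simp only [inner_sub_right]
  have hmean : ∫ θ, inner ℝ t (N x θ - ν) ∂DΘ = 0 := by
    rw [hsub, integral_sub (hint.const_inner t) (integrable_const _), integral_inner hint]
    simp [hν, EnsembleAveraging.outputMean]
  have hvar : Var[fun θ => inner ℝ t (N x θ - ν); DΘ] = Var[fun θ => inner ℝ t (N x θ); DΘ] := by
    rw [hsub, variance_sub_const hL.aestronglyMeasurable]
  have hlim := tendsto_charFun_inv_sqrt_pow ((hN.sub (memLp_const ν)).const_inner t) hmean
  simp only [Pi.sub_apply, hvar] at hlim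
  simp only [ProbabilityMeasure.coe_mk, Measure.map_id,
    charFun_multivariateGaussian (EnsembleAveraging.posSemidef_outputCov hN),
    EnsembleAveraging.dotProduct_outputCov_mulVec hN]
  simp only [inner_zero_right, Complex.ofReal_zero, zero_mul, zero_sub, ← neg_div]
  refine hlim.congr' ?_
  filter_upwards [eventually_ne_atTop 0] with K hK
  simp only [EnsembleAveraging.sqrt_smul_ensembleAverage_sub hK]
  rw [charFun_map_inv_sqrt_smul_sum (hclaw K) (hcindep K),
    charFun_map_smul_eq_charFun_map_inner hcm, Fintype.card_fin]
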